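/- There is an absolute constant $C>0$ such that the following holds for every integer $t\ge 3$. Let $G$ be a finite simple graph that contains no cycle of length $2t$ as a (not necessarily induced) subgraph, and whose maximum degree $\Delta$ satisfies $\Delta\ge t^3$. Then $$\chi_a(G)\;\le\; 2\Delta + C\,t\,\Delta^{2/3}.$$ Here $\chi_a(G)$, the acyclic chromatic number of $G$, is the minimum integer $k$ such that $G$ has a proper vertex colouring with $k$ colours in which the union of any two colour classes induces a forest. -/

import Mathlib

namespace SimpleGraph

/-- A proper colouring of `G` is acyclic if any two colour classes together induce a forest,
i.e. every cycle of `G` receives at least three colours. -/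
def Coloring.IsAcyclic {V α : Type*} {G : SimpleGraph V} (c : G.Coloring α) : Prop :=
  ∀ a b : α, (G.induce {v | c v = a ∨ c v = b}).IsAcyclic

/-- `G` has an acyclic colouring with `k` colours (not all of which need be used). -/
def AcyclicColorable {V : Type*} (G : SimpleGraph V) (k : ℕ) : Prop :=
  ∃ c : G.Coloring (Fin k), c.IsAcyclic

/-- The acyclic chromatic number: the minimum `k` such that `G` has an acyclic `k`-colouring.
For finite `G` the minimum exists, see `acyclicColorable_acyclicChromaticNumber`. -/
noncomputable def acyclicChromaticNumber {V : Type*} (G : SimpleGraph V) : ℕ :=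
  sInf {k : ℕ | G.AcyclicColorable k}

theorem acyclicColorable_card {V : Type*} [Fintype V] (G : SimpleGraph V) :
    G.AcyclicColorable (Fintype.card V) := by
  classical
  let e := Fintype.equivFin V
  refine ⟨Coloring.mk e fun {u v} h he => h.ne (e.injective he), fun a b v w hw => ?_⟩
  have h3 : 3 ≤ w.length := hw.three_le_length
  have hnd := hw.support_nodup
  have hsub : ∀ x ∈ w.support.tail,
      (x : V) ∈ ({e.symm a, e.symm b} : Finset V) := by
    intro x _
    rcases x.2 with h | h
    · simp only [Finset.mem_insert, Finset.mem_singleton]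
      exact Or.inl (e.eq_symm_apply.2 h)
    · simp only [Finset.mem_insert, Finset.mem_singleton]
      exact Or.inr (e.eq_symm_apply.2 h)
  have hcard : (w.support.tail.map Subtype.val).toFinset.card = w.length := by
    rw [List.toFinset_card_of_nodup (hnd.map Subtype.val_injective)]
    simp
  have hle : (w.support.tail.map Subtype.val).toFinset ⊆ ({e.symm a, e.symm b} : Finset V) := by
    intro y hy
    obtain ⟨x, hx, rfl⟩ := List.mem_map.1 (List.mem_toFinset.1 hy)
    exact hsub x hx
  have h2 := (Finset.card_le_card hle).trans Finset.card_le_two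
  omega

/-- On finite graphs the minimum defining the acyclic chromatic number is attained. -/
theorem acyclicColorable_acyclicChromaticNumber {V : Type*} [Fintype V] (G : SimpleGraph V) :
    G.AcyclicColorable G.acyclicChromaticNumber :=
  Nat.sInf_mem (s := {k : ℕ | G.AcyclicColorable k}) ⟨_, G.acyclicColorable_card⟩

end SimpleGraph

/-! Call two distinct vertices crowded if they have at least `s` common neighbours, and require
crowded pairs to get different colours too. Rosenfeld's counting method then applies. Count the
functions `V → Fin k` that are such colourings on `S` and free elsewhere. By induction on `S`, each
new vertex `v` has in effect at least `β` colours. The losses at `v` are of two kinds: `v` repeats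
the colour of a neighbour or crowded partner (weight 1 each), or a two-coloured cycle through `v`
appears. On a cycle of length `n + 4` an alternating colouring is fixed by two vertices, so it has
weight `β⁻⁽ⁿ⁺¹⁾`. It suffices that `β` plus the total weight is at most `k`.

Excluding `C_{2t}` bounds the crowded partners of a vertex by `4tΔ/s` (`mul_card_large_codegree_le`)
and the cycles of length `n + 4` through it without crowded pairs at distance two by `28 s t² Δⁿ⁺¹`
(`card_uncrowdedCycles_le`). If the underlying counts were larger, pruning would leave sets inside
two neighbourhoods between which paths grow greedily in steps of length two and close into a
`C_{2t}`.

One `Δ` in the bound pays for the neighbours, the other for `β > Δ`, which makes the sum over cycle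
lengths converge. With `s` of order `Δ^{1/3}` and `β = Δ + tΔ^{2/3}`, all other terms are
`O(tΔ^{2/3})`. -/

namespace SimpleGraph

/-! ### Building a cycle of length `2t` from expanding sets. -/

section ExpandingPairs

variable {V : Type*} {G : SimpleGraph V}

/-- From every vertex of `X` there is a path of length two to a vertex of `Y` that
avoids any prescribed set of at most `m` vertices. -/
def TwoStepExpands (G : SimpleGraph V) (m : ℕ) (X Y : Set V) : Prop :=
  ∀ x ∈ X, ∀ F : Finset V, F.card ≤ m →
    ∃ b, ∃ y ∈ Y, G.Adj x b ∧ G.Adj b y ∧ b ∉ F ∧ y ∉ F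

/-- Greedy growth: each two-step adds its two used vertices to the forbidden set, hence the budget
`2 * n`. `X` and `Y` swap roles at every step, hence the parity clauses. -/
theorem TwoStepExpands.exists_isPath [DecidableEq V] {m n : ℕ} {X Y : Set V}
    (hXY : G.TwoStepExpands m X Y) (hYX : G.TwoStepExpands m Y X) {x : V} (hx : x ∈ X)
    (F : Finset V) (hF : F.card + 2 * n ≤ m) :
    ∃ z, ∃ p : G.Walk x z, p.IsPath ∧ p.length = 2 * n ∧ (∀ w ∈ p.support, w ≠ x → w ∉ F) ∧
      (Even n → z ∈ X) ∧ (Odd n → z ∈ Y) := by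
  induction n generalizing X Y x F with
  | zero => exact ⟨x, .nil, by simp, by simp, by simp, by simp [hx], by simp⟩
  | succ n ih =>
    obtain ⟨b, y, hy, hxb, hby, hb, hyF⟩ := hXY x hx (insert x F)
      ((Finset.card_insert_le _ _).trans (by omega))
    have h1 := Finset.card_insert_le b F
    have h2 := Finset.card_insert_le x (insert b F)
    obtain ⟨z, p, hp, hl, hav, he, ho⟩ := ih hYX hXY hy (insert x (insert b F)) (by omega)
    simp only [Finset.mem_insert, not_or] at hb hyF hav
    have hbp : b ∉ p.support := fun h => (hav b h hby.ne).2.1 rfl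
    have hxp : x ∉ p.support := fun h => (hav x h (Ne.symm hyF.1)).1 rfl
    refine ⟨z, .cons hxb (.cons hby p), ?_, ?_, ?_, ?_, ?_⟩
    · simp [Walk.cons_isPath_iff, hp, hbp, hxp, hxb.ne]
    · simp [hl]; ring
    · intro w hw hwx
      simp only [Walk.support_cons, List.mem_cons] at hw
      rcases hw with rfl | rfl | hw
      · exact absurd rfl hwx
      · exact hb.2
      · by_cases hwy : w = y
        · exact hwy ▸ hyF.2
        · exact (hav w hw hwy).2.2
    · intro h
      exact ho (by rcases Nat.even_or_odd n with h' | h'; · exact absurd h (by simp [Nat.even_add_one, h'])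
                   · exact h')
    · intro h
      exact he (by rcases Nat.even_or_odd n with h' | h'; · exact h'
                   · exact absurd h (by simp [Nat.odd_add_one, h']))

theorem isCycle_cons_concat {v c z : V} (p : G.Walk c z) (hp : p.IsPath) (hv : v ∉ p.support)
    (hvc : G.Adj v c) (hzv : G.Adj z v) (hl : 1 ≤ p.length) :
    (Walk.cons hvc (p.concat hzv)).IsCycle := by
  rw [Walk.isCycle_iff_isPath_tail_and_le_length]
  refine ⟨?_, by simp; omega⟩
  have := hp.concat hv hzv
  simpa using this

/-- Two mutually expanding sets inside the neighbourhoods of two (possibly equal) vertices force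
a cycle of length `2 * t`. -/
theorem TwoStepExpands.cycleGraph_isContained [DecidableEq V] {t : ℕ} (ht : 3 ≤ t) {u v : V}
    {X Y : Set V} (hX : ∀ x ∈ X, G.Adj u x) (hY : ∀ y ∈ Y, G.Adj v y) (hne : Y.Nonempty)
    (hXY : G.TwoStepExpands (2 * t) X Y) (hYX : G.TwoStepExpands (2 * t) Y X) :
    cycleGraph (2 * t) ⊑ G := by
  rw [cycleGraph_isContained_iff (by omega)]
  obtain ⟨c, hc⟩ := hne
  -- Here a path of `t - 1` two-steps from `c` ends in a neighbour of `v`, so `v` closes it up.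
  by_cases h : u = v ∨ Odd t
  · obtain ⟨z, p, hp, hl, hav, he, ho⟩ := hYX.exists_isPath hXY hc {v} (n := t - 1)
      (by simp; omega)
    have hz : G.Adj v z := by
      rcases Nat.even_or_odd (t - 1) with h' | h'
      · exact hY z (he h')
      · rcases h with rfl | h
        · exact hX z (ho h')
        · exact absurd h (by rw [Nat.odd_sub (by omega)] at h'; simp_all)
    have hvp : v ∉ p.support := fun h => by simpa using hav v h (hY c hc).ne
    exact ⟨v, _, isCycle_cons_concat p hp hvp (hY c hc) hz.symm (by omega), by simp; omega⟩
  · push Not at h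
    obtain ⟨huv, ht2⟩ := h
    have ht2 : Even t := Nat.not_odd_iff_even.1 ht2
    -- The parity is now wrong, and a detour through `u` corrects it: the cycle is `v c b a u a' … z
    -- v`, where `a` and `a'` both lie in `X` and `t - 3` two-steps, an odd number, lead from `a'`
    -- to `z ∈ Y`. The vertex `c` is chosen anew because the given one may equal `u`.
    obtain ⟨-, a, ha, -⟩ := hYX c hc ∅ (by simp)
    obtain ⟨-, c, hc, -, -, -, hcF⟩ := hXY a ha {u, v} ((Finset.card_le_two).trans (by omega))
    obtain ⟨b, a, ha, hcb, hba, hbF, haF⟩ := hYX c hc {u, v, c}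
      ((Finset.card_le_three).trans (by omega))
    obtain ⟨-, a', ha', -, -, -, haF'⟩ := hYX c hc {u, v, c, b, a}
      ((Finset.card_le_five).trans (by omega))
    have h5 := Finset.card_le_five (a := u) (b := v) (c := c) (d := b) (e := a)
    have hodd : Odd (t - 3) := by
      obtain ⟨k, hk⟩ := ht2
      exact ⟨k - 2, by omega⟩
    obtain ⟨z, p, hp, hl, hav, he, ho⟩ := hXY.exists_isPath hYX ha' {u, v, c, b, a} (n := t - 3)
      (by omega)
    have hz := hY z (ho hodd)
    simp only [Finset.mem_insert, Finset.mem_singleton, not_or] at hcF hbF haF haF' hav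
    obtain ⟨h1, h2, h3, h4, h5⟩ := haF'
    have k1 : u ∉ p.support := fun h => (hav u h (Ne.symm h1)).1 rfl
    have k2 : v ∉ p.support := fun h => (hav v h (Ne.symm h2)).2.1 rfl
    have k3 : c ∉ p.support := fun h => (hav c h (Ne.symm h3)).2.2.1 rfl
    have k4 : b ∉ p.support := fun h => (hav b h (Ne.symm h4)).2.2.2.1 rfl
    have k5 : a ∉ p.support := fun h => (hav a h (Ne.symm h5)).2.2.2.2 rfl
    refine ⟨v, _, isCycle_cons_concat
      (.cons hcb (.cons hba (.cons (hX a ha).symm (.cons (hX a' ha') p))))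
      ?_ ?_ (hY c hc) hz.symm (by simp), by simp; omega⟩
    · simp [Walk.cons_isPath_iff, hp, k1, k3, k4, k5, hcb.ne, hba.ne, hcF, hbF, haF, Ne.symm haF.2.2]
    · simp [k2, Ne.symm hcF.2, Ne.symm hbF.2.1, Ne.symm haF.2.1, huv.symm]

end ExpandingPairs

end SimpleGraph

/-- View `E` as a bipartite graph. Deleting a vertex of degree at most `m` loses at most `m` edges
and lowers the left side of `hE` by at least `m`, so the strict inequality survives and the deletion
stops at a nonempty graph. -/
theorem Finset.exists_subset_lt_card_fibers {α β : Type*} [DecidableEq α] [DecidableEq β] (m : ℕ)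
    (E : Finset (α × β)) (hE : m * ((E.image Prod.fst).card + (E.image Prod.snd).card) < E.card) :
    ∃ E' ⊆ E, E'.Nonempty ∧ ∀ p ∈ E', m < (E'.filter fun q => q.1 = p.1).card ∧
      m < (E'.filter fun q => q.2 = p.2).card := by
  induction E using Finset.strongInduction with
  | H E ih =>
    by_cases h : ∀ p ∈ E, m < (E.filter fun q => q.1 = p.1).card ∧
      m < (E.filter fun q => q.2 = p.2).card
    · exact ⟨E, subset_rfl, Finset.card_pos.1 (by omega), h⟩
    push Not at h
    obtain ⟨p, hp, h⟩ := h
    by_cases h1 : m < (E.filter fun q => q.1 = p.1).card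
    · have h2 := h h1
      have hc := E.card_filter_add_card_filter_not (fun q => q.2 = p.2)
      set E'' := E.filter fun q => ¬ q.2 = p.2 with hE''
      have hsub : E'' ⊂ E := Finset.filter_ssubset.2 ⟨p, hp, by simp⟩
      have i1 : (E''.image Prod.fst).card ≤ (E.image Prod.fst).card :=
        Finset.card_le_card (Finset.image_subset_image hsub.1)
      have i2 : (E''.image Prod.snd).card < (E.image Prod.snd).card := by
        apply Finset.card_lt_card
        refine Finset.ssubset_iff_of_subset (Finset.image_subset_image hsub.1) |>.2
          ⟨p.2, Finset.mem_image_of_mem _ hp, ?_⟩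
        simp [hE'']
      obtain ⟨E', hE', hr⟩ := ih E'' hsub (by
        have : m * ((E''.image Prod.fst).card + (E''.image Prod.snd).card + 1) ≤
          m * ((E.image Prod.fst).card + (E.image Prod.snd).card) :=
            Nat.mul_le_mul_left _ (by omega)
        rw [mul_add] at this; omega)
      exact ⟨E', hE'.trans hsub.1, hr⟩
    · have h2 := not_lt.1 h1
      have hc := E.card_filter_add_card_filter_not (fun q => q.1 = p.1)
      set E'' := E.filter fun q => ¬ q.1 = p.1 with hE''
      have hsub : E'' ⊂ E := Finset.filter_ssubset.2 ⟨p, hp, by simp⟩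
      have i1 : (E''.image Prod.snd).card ≤ (E.image Prod.snd).card :=
        Finset.card_le_card (Finset.image_subset_image hsub.1)
      have i2 : (E''.image Prod.fst).card < (E.image Prod.fst).card := by
        apply Finset.card_lt_card
        refine Finset.ssubset_iff_of_subset (Finset.image_subset_image hsub.1) |>.2
          ⟨p.1, Finset.mem_image_of_mem _ hp, ?_⟩
        simp [hE'']
      obtain ⟨E', hE', hr⟩ := ih E'' hsub (by
        have : m * ((E''.image Prod.fst).card + (E''.image Prod.snd).card + 1) ≤
          m * ((E.image Prod.fst).card + (E.image Prod.snd).card) :=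
            Nat.mul_le_mul_left _ (by omega)
        rw [mul_add] at this; omega)
      exact ⟨E', hE'.trans hsub.1, hr⟩

theorem Finset.exists_mem_apply_notMem_of_card_lt {α β : Type*} [DecidableEq β] {S : Finset α}
    {f : α → β} (hf : Set.InjOn f S) {F : Finset β} (h : F.card < S.card) :
    ∃ x ∈ S, f x ∉ F := by
  rw [← Finset.card_image_of_injOn hf] at h
  obtain ⟨y, hy, hyF⟩ := Finset.exists_mem_notMem_of_card_lt_card h
  obtain ⟨x, hx, rfl⟩ := Finset.mem_image.1 hy
  exact ⟨x, hx, hyF⟩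

namespace SimpleGraph

/-- A set `F` of at most `M` vertices spoils at most `M` endpoints directly and at most `D` more
through each middle vertex in `F`. -/
theorem twoStepExpands_of_lt_card {V : Type*} [Fintype V] [DecidableEq V] {G : SimpleGraph V}
    {R : V → V → V → Prop} [∀ a b c, Decidable (R a b c)]
    {M D m : ℕ} {X Y : Set V}
    (hadj : ∀ a b c, R a b c → G.Adj a b ∧ G.Adj b c ∧ c ∈ Y)
    (hD : ∀ a b, (Finset.univ.filter fun c => R a b c).card ≤ D)
    (hm : M + M * D ≤ m)
    (hdeg : ∀ x ∈ X, m < (Finset.univ.filter fun c => ∃ b, R x b c).card) :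
    G.TwoStepExpands M X Y := by
  intro x hx F hF
  have h1 : (F ∪ F.biUnion fun b => Finset.univ.filter fun c => R x b c).card ≤ m := by
    refine (Finset.card_union_le _ _).trans (le_trans (add_le_add hF ?_) hm)
    exact (Finset.card_biUnion_le_card_mul _ _ _ fun b _ => hD x b).trans
      (Nat.mul_le_mul_right _ hF)
  obtain ⟨c, hc, hcn⟩ := Finset.exists_mem_notMem_of_card_lt_card (h1.trans_lt (hdeg x hx))
  obtain ⟨b, hb⟩ := (Finset.mem_filter.1 hc).2
  simp only [Finset.mem_union, Finset.mem_biUnion, Finset.mem_filter, Finset.mem_univ, true_and,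
    not_or, not_exists, not_and] at hcn
  obtain ⟨h2, h3, h4⟩ := hadj x b c hb
  exact ⟨b, c, h4, h2, h3, fun hbF => hcn.2 b hbF hb, hcn.1⟩

/-! ### Codegrees and four-edge paths in graphs without `C_{2t}`. -/

section LocalCounting

variable {V : Type*} [Fintype V] (G : SimpleGraph V) [DecidableRel G.Adj]

/-- The number of common neighbours of two vertices. -/
def codegree (x y : V) : ℕ := (Finset.univ.filter fun b => G.Adj x b ∧ G.Adj b y).card

theorem codegree_comm (x y : V) : G.codegree x y = G.codegree y x := by
  unfold codegree
  congr 1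
  ext b
  simp [G.adj_comm, and_comm]

variable {G}

theorem card_le_maxDegree_of_forall_adj {v : V} {S : Finset V} (h : ∀ x ∈ S, G.Adj v x) :
    S.card ≤ G.maxDegree :=
  (Finset.card_le_card fun x hx => (G.mem_neighborFinset v x).2 (h x hx)).trans
    (G.degree_le_maxDegree v)

/-- Two distinct vertices with at least `s` common neighbours. -/
def Crowded (G : SimpleGraph V) [DecidableRel G.Adj] (s : ℕ) (x y : V) : Prop :=
  s ≤ G.codegree x y ∧ y ≠ x

theorem Crowded.symm {s : ℕ} {x y : V} (h : G.Crowded s x y) : G.Crowded s y x :=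
  ⟨G.codegree_comm x y ▸ h.1, h.2.symm⟩

variable [DecidableEq V]

/-- The number of edges between the neighbourhood of `v` and the vertices having many common
neighbours with `v` is linear in the maximum degree. -/
theorem card_edges_to_large_codegree_le {t : ℕ} (ht : 3 ≤ t) (hG : (cycleGraph (2 * t)).Free G)
    (v : V) :
    (Finset.univ.filter fun p : V × V => G.Adj v p.1 ∧ G.Adj p.1 p.2 ∧
      4 * t ≤ G.codegree v p.2 ∧ p.2 ≠ v).card ≤ 4 * t * G.maxDegree := by
  by_contra! hlt
  set E := Finset.univ.filter fun p : V × V => G.Adj v p.1 ∧ G.Adj p.1 p.2 ∧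
      4 * t ≤ G.codegree v p.2 ∧ p.2 ≠ v with hE
  have hmem : ∀ p ∈ E, G.Adj v p.1 ∧ G.Adj p.1 p.2 ∧
      4 * t ≤ G.codegree v p.2 ∧ p.2 ≠ v := by simp [hE]
  have h1 : (E.image Prod.fst).card ≤ G.maxDegree := by
    apply card_le_maxDegree_of_forall_adj (v := v)
    simp only [Finset.mem_image]
    rintro x ⟨p, hp, rfl⟩
    exact (hmem p hp).1
  have h2 : 4 * t * (E.image Prod.snd).card ≤ E.card := by
    rw [Finset.card_eq_sum_card_image Prod.snd E, mul_comm, ← smul_eq_mul]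
    apply Finset.card_nsmul_le_sum
    simp only [Finset.mem_image]
    rintro b ⟨p, hp, rfl⟩
    obtain ⟨-, -, h3, h4⟩ := hmem p hp
    refine h3.trans ?_
    unfold codegree
    apply Finset.card_le_card_of_injOn (fun a => (a, p.2))
    · intro a ha
      simp only [Finset.coe_filter, Finset.mem_univ, true_and, Set.mem_ofPred_eq] at ha
      simp [hE, ha, h3, h4]
    · intro a _ a' _ h
      exact (Prod.ext_iff.1 h).1
  -- Let `a`, `b` be the sizes of the two sides. Since `a ≤ Δ` and `4tb ≤ |E|`, we get `2t(a + b) ≤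
  -- 2tΔ + |E|/2 < |E|`.
  obtain ⟨E', hsub, ⟨p, hp⟩, hdeg⟩ := Finset.exists_subset_lt_card_fibers (2 * t) E (by nlinarith)
  have hex : G.TwoStepExpands (2 * t) {a | ∃ b, (a, b) ∈ E'} {a | ∃ b, (a, b) ∈ E'} := by
    rintro x ⟨b, hb⟩ F hF
    obtain ⟨q, hq, hqF⟩ := Finset.exists_mem_apply_notMem_of_card_lt
      (S := E'.filter fun q => q.1 = x) (f := Prod.snd) (F := F)
      (fun a ha a' ha' h => Prod.ext
        ((Finset.mem_filter.1 ha).2.trans (Finset.mem_filter.1 ha').2.symm) h)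
      (hF.trans_lt (hdeg _ hb).1)
    have hqE := (Finset.mem_filter.1 hq).1
    obtain rfl := (Finset.mem_filter.1 hq).2
    obtain ⟨r, hr, hrF⟩ := Finset.exists_mem_apply_notMem_of_card_lt
      (S := E'.filter fun r => r.2 = q.2) (f := Prod.fst) (F := F)
      (fun a ha a' ha' h => Prod.ext h
        ((Finset.mem_filter.1 ha).2.trans (Finset.mem_filter.1 ha').2.symm))
      (hF.trans_lt (hdeg _ hqE).2)
    obtain ⟨hr, hrq⟩ := Finset.mem_filter.1 hr
    exact ⟨q.2, r.1, ⟨r.2, hr⟩, (hmem q (hsub hqE)).2.1, hrq ▸ (hmem r (hsub hr)).2.1.symm,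
      hqF, hrF⟩
  have hN : ∀ a ∈ {a | ∃ b, (a, b) ∈ E'}, G.Adj v a := fun a ⟨b, hb⟩ => (hmem _ (hsub hb)).1
  exact hG (hex.cycleGraph_isContained ht hN hN ⟨p.1, p.2, hp⟩ hex)

/-- Double counting: each such vertex receives at least `s` of the edges bounded in
`card_edges_to_large_codegree_le`. -/
theorem mul_card_large_codegree_le {t s : ℕ} (ht : 3 ≤ t) (hG : (cycleGraph (2 * t)).Free G)
    (hs : 4 * t ≤ s) (v : V) :
    s * (Finset.univ.filter fun b => s ≤ G.codegree v b ∧ b ≠ v).card ≤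
      4 * t * G.maxDegree := by
  refine le_trans ?_ (card_edges_to_large_codegree_le ht hG v)
  set B := Finset.univ.filter fun b => s ≤ G.codegree v b ∧ b ≠ v with hB
  have : s * B.card ≤ (B.sigma fun b => Finset.univ.filter fun a => G.Adj v a ∧ G.Adj a b).card := by
    rw [Finset.card_sigma, mul_comm, ← smul_eq_mul]
    apply Finset.card_nsmul_le_sum
    intro b hb
    exact (Finset.mem_filter.1 hb).2.1
  refine this.trans (Finset.card_le_card_of_injOn (fun q => (q.2, q.1)) ?_ ?_)
  · rintro ⟨b, a⟩ h
    simp only [hB, Finset.coe_sigma, Set.mem_sigma_iff, Finset.mem_coe, Finset.mem_filter,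
      Finset.mem_univ, true_and] at h
    simp [h, hs.trans h.1.1]
  · rintro ⟨b, a⟩ _ ⟨b', a'⟩ _ h
    simp_all

/-- A pair `(a, c)` of second and fourth vertices has at most `s` middles, so it is enough to bound
the pairs. Too many pairs would prune to minimum degree above `m`. Given the middle `b`, the vertex
`c` is a common neighbour of `b` and `v`, leaving at most `D` choices, and likewise for `a` and `u`.
So the two sides expand into each other and force a `C_{2t}`. -/
theorem card_paths_small_codegree_le {t s D : ℕ} (ht : 3 ≤ t) (hG : (cycleGraph (2 * t)).Free G)
    (u v : V) (T : Finset (V × V × V))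
    (hT : ∀ p ∈ T, G.Adj u p.1 ∧ G.Adj p.1 p.2.1 ∧ G.Adj p.2.1 p.2.2 ∧ G.Adj p.2.2 v ∧
      G.codegree p.1 p.2.2 ≤ s ∧ G.codegree u p.2.1 ≤ D ∧ G.codegree v p.2.1 ≤ D) :
    T.card ≤ s * ((2 * t + 2 * t * D) * (2 * G.maxDegree)) := by
  set m := 2 * t + 2 * t * D with hm
  set E := T.image fun p => (p.1, p.2.2) with hE
  have hTE : T.card ≤ s * E.card := by
    apply Finset.card_le_mul_card_image
    intro q hq
    obtain ⟨p, hp, rfl⟩ := Finset.mem_image.1 hq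
    refine le_trans ?_ (hT p hp).2.2.2.2.1
    apply Finset.card_le_card_of_injOn (fun r => r.2.1)
    · intro r hr
      simp only [Finset.coe_filter, Set.mem_ofPred_eq, Prod.mk.injEq] at hr
      obtain ⟨hr, h1, h2⟩ := hr
      have := hT r hr
      simp [← h1, ← h2, this]
    · intro r hr r' hr' h
      simp only [Finset.coe_filter, Set.mem_ofPred_eq, Prod.mk.injEq] at hr hr' h
      exact Prod.ext (hr.2.1.trans hr'.2.1.symm) (Prod.ext h (hr.2.2.trans hr'.2.2.symm))
  refine hTE.trans (Nat.mul_le_mul_left _ ?_)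
  by_contra! hlt
  have hEm : ∀ p ∈ E, ∃ b, (p.1, b, p.2) ∈ T := by
    intro p hp
    obtain ⟨r, hr, rfl⟩ := Finset.mem_image.1 hp
    exact ⟨r.2.1, hr⟩
  have h1 : (E.image Prod.fst).card ≤ G.maxDegree := by
    apply card_le_maxDegree_of_forall_adj (v := u)
    simp only [Finset.mem_image]
    rintro x ⟨p, hp, rfl⟩
    obtain ⟨b, hb⟩ := hEm p hp
    exact (hT _ hb).1
  have h2 : (E.image Prod.snd).card ≤ G.maxDegree := by
    apply card_le_maxDegree_of_forall_adj (v := v)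
    simp only [Finset.mem_image]
    rintro x ⟨p, hp, rfl⟩
    obtain ⟨b, hb⟩ := hEm p hp
    exact (hT _ hb).2.2.2.1.symm
  obtain ⟨E', hsub, ⟨p, hp⟩, hdeg⟩ := Finset.exists_subset_lt_card_fibers m E
    ((Nat.mul_le_mul_left m (by omega)).trans_lt hlt)
  have hXY : G.TwoStepExpands (2 * t) {a | ∃ c, (a, c) ∈ E'} {c | ∃ a, (a, c) ∈ E'} := by
    refine twoStepExpands_of_lt_card (R := fun a b c => (a, c) ∈ E' ∧ (a, b, c) ∈ T) (D := D)
      (m := m) ?_ ?_ hm.symm.le ?_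
    · rintro a b c ⟨h, h'⟩
      exact ⟨(hT _ h').2.1, (hT _ h').2.2.1, a, h⟩
    · intro a b
      by_cases hne : ∃ c, (a, b, c) ∈ T
      · obtain ⟨c, hc⟩ := hne
        refine le_trans (Finset.card_le_card ?_) (hT _ hc).2.2.2.2.2.2
        intro c' hc'
        have := hT _ (Finset.mem_filter.1 hc').2.2
        simp [this.2.2.1.symm, this.2.2.2.1.symm]
      · simp only [not_exists] at hne
        simp [hne]
    · rintro a ⟨c, hc⟩
      refine (hdeg _ hc).1.trans_le (Finset.card_le_card_of_injOn Prod.snd ?_ ?_)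
      · rintro ⟨a', c'⟩ h
        simp only [Finset.coe_filter, Set.mem_ofPred_eq] at h
        obtain ⟨h, rfl⟩ := h
        obtain ⟨b, hb⟩ := hEm _ (hsub h)
        simpa [h] using ⟨b, hb⟩
      · intro q hq q' hq' h
        exact Prod.ext ((Finset.mem_filter.1 hq).2.trans (Finset.mem_filter.1 hq').2.symm) h
  have hYX : G.TwoStepExpands (2 * t) {c | ∃ a, (a, c) ∈ E'} {a | ∃ c, (a, c) ∈ E'} := by
    refine twoStepExpands_of_lt_card (R := fun c b a => (a, c) ∈ E' ∧ (a, b, c) ∈ T) (D := D)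
      (m := m) ?_ ?_ hm.symm.le ?_
    · rintro c b a ⟨h, h'⟩
      exact ⟨(hT _ h').2.2.1.symm, (hT _ h').2.1.symm, c, h⟩
    · intro c b
      by_cases hne : ∃ a, (a, b, c) ∈ T
      · obtain ⟨a, ha⟩ := hne
        refine le_trans (Finset.card_le_card ?_) (hT _ ha).2.2.2.2.2.1
        intro a' ha'
        have := hT _ (Finset.mem_filter.1 ha').2.2
        simp [this.1, this.2.1]
      · simp only [not_exists] at hne
        simp [hne]
    · rintro c ⟨a, ha⟩
      refine (hdeg _ ha).2.trans_le (Finset.card_le_card_of_injOn Prod.fst ?_ ?_)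
      · rintro ⟨a', c'⟩ h
        simp only [Finset.coe_filter, Set.mem_ofPred_eq] at h
        obtain ⟨h, rfl⟩ := h
        obtain ⟨b, hb⟩ := hEm _ (hsub h)
        simpa [h] using ⟨b, hb⟩
      · intro q hq q' hq' h
        exact Prod.ext h ((Finset.mem_filter.1 hq).2.trans (Finset.mem_filter.1 hq').2.symm)
  have hne : {c | ∃ a, (a, c) ∈ E'}.Nonempty := ⟨p.2, p.1, hp⟩
  refine hG (hXY.cycleGraph_isContained ht (u := u) (v := v) ?_ ?_ hne hYX)
  · rintro a ⟨c, h⟩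
    obtain ⟨b, hb⟩ := hEm _ (hsub h)
    exact (hT _ hb).1
  · rintro c ⟨a, h⟩
    obtain ⟨b, hb⟩ := hEm _ (hsub h)
    exact (hT _ hb).2.2.2.1.symm

/-- If the middle vertex has at least `4t` common neighbours with `u`, the edge from the second
vertex to it is one of at most `4tΔ`, and fewer than `s` choices remain for the fourth vertex. The
case of `v` is symmetric. The remaining paths fall under the previous lemma with `D = 4t`. -/
theorem card_paths_le {t s : ℕ} (ht : 3 ≤ t) (hG : (cycleGraph (2 * t)).Free G)
    (u v : V) (T : Finset (V × V × V))
    (hT : ∀ p ∈ T, (G.Adj u p.1 ∧ G.Adj p.1 p.2.1 ∧ G.Adj p.2.1 p.2.2 ∧ G.Adj p.2.2 v) ∧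
      (p.2.2 ≠ p.1 ∧ p.2.1 ≠ u ∧ p.2.1 ≠ v) ∧
      G.codegree p.1 p.2.2 < s ∧ G.codegree u p.2.1 < s ∧ G.codegree v p.2.1 < s) :
    T.card ≤ 28 * (s * t ^ 2 * G.maxDegree) := by
  set A := T.filter fun p => 4 * t ≤ G.codegree u p.2.1 with hA
  set B := T.filter fun p => 4 * t ≤ G.codegree v p.2.1 with hB
  set C := T.filter fun p => G.codegree u p.2.1 ≤ 4 * t ∧ G.codegree v p.2.1 ≤ 4 * t with hC
  have hsub : T ⊆ A ∪ B ∪ C := by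
    intro p hp
    simp only [hA, hB, hC, Finset.mem_union, Finset.mem_filter, hp, true_and]
    omega
  have h1 : A.card ≤ s * (4 * t * G.maxDegree) := by
    refine le_trans (Finset.card_le_mul_card_image (f := fun p => (p.1, p.2.1)) A s ?_)
      (Nat.mul_le_mul_left s
        (le_trans (Finset.card_le_card ?_) (card_edges_to_large_codegree_le ht hG u)))
    · intro q hq
      obtain ⟨p, hp, rfl⟩ := Finset.mem_image.1 hq
      have hp' := hT p (Finset.mem_filter.1 hp).1
      refine le_trans (Finset.card_le_card_of_injOn (fun r => r.2.2) ?_ ?_) hp'.2.2.2.2.le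
      · intro r hr
        simp only [Finset.coe_filter, Set.mem_ofPred_eq, Prod.mk.injEq] at hr
        have := hT r (Finset.mem_filter.1 hr.1).1
        simp [← hr.2.2, this.1.2.2.1.symm, this.1.2.2.2.symm]
      · intro r hr r' hr' h
        simp only [Finset.coe_filter, Set.mem_ofPred_eq, Prod.mk.injEq] at hr hr' h
        exact Prod.ext (hr.2.1.trans hr'.2.1.symm) (Prod.ext (hr.2.2.trans hr'.2.2.symm) h)
    · intro q hq
      obtain ⟨p, hp, rfl⟩ := Finset.mem_image.1 hq
      obtain ⟨hp, hp2⟩ := Finset.mem_filter.1 hp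
      have := hT p hp
      simp [this, hp2]
  have h2 : B.card ≤ s * (4 * t * G.maxDegree) := by
    refine le_trans (Finset.card_le_mul_card_image (f := fun p => (p.2.2, p.2.1)) B s ?_)
      (Nat.mul_le_mul_left s
        (le_trans (Finset.card_le_card ?_) (card_edges_to_large_codegree_le ht hG v)))
    · intro q hq
      obtain ⟨p, hp, rfl⟩ := Finset.mem_image.1 hq
      have hp' := hT p (Finset.mem_filter.1 hp).1
      refine le_trans (Finset.card_le_card_of_injOn (fun r => r.1) ?_ ?_) hp'.2.2.2.1.le
      · intro r hr
        simp only [Finset.coe_filter, Set.mem_ofPred_eq, Prod.mk.injEq] at hr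
        have := hT r (Finset.mem_filter.1 hr.1).1
        simp [← hr.2.2, this.1.1, this.1.2.1]
      · intro r hr r' hr' h
        simp only [Finset.coe_filter, Set.mem_ofPred_eq, Prod.mk.injEq] at hr hr' h
        exact Prod.ext h (Prod.ext (hr.2.2.trans hr'.2.2.symm) (hr.2.1.trans hr'.2.1.symm))
    · intro q hq
      obtain ⟨p, hp, rfl⟩ := Finset.mem_image.1 hq
      obtain ⟨hp, hp2⟩ := Finset.mem_filter.1 hp
      have := hT p hp
      simp [this, hp2, this.1.2.2.1.symm, this.1.2.2.2.symm]
  have h3 : C.card ≤ s * ((2 * t + 2 * t * (4 * t)) * (2 * G.maxDegree)) := by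
    apply card_paths_small_codegree_le ht hG u v
    intro p hp
    obtain ⟨hp, hp1, hp2⟩ := Finset.mem_filter.1 hp
    have := hT p hp
    exact ⟨this.1.1, this.1.2.1, this.1.2.2.1, this.1.2.2.2, this.2.2.1.le, hp1, hp2⟩
  have h4 := (Finset.card_le_card hsub).trans ((Finset.card_union_le _ _).trans
    (add_le_add_left (Finset.card_union_le A B) _))
  -- The three cases add up to `sΔ(12t + 16t²)`.
  have h5 : s * G.maxDegree * (12 * t) ≤ s * G.maxDegree * (12 * t ^ 2) := by
    gcongr; nlinarith
  nlinarith

end LocalCounting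

end SimpleGraph

namespace SimpleGraph

/-! ### Counting uncrowded cycles through a vertex. -/

section CycleCounting

variable {V : Type*} [Fintype V] [DecidableEq V] (G : SimpleGraph V) [DecidableRel G.Adj]

theorem sum_card_finsetWalkLength_le (n : ℕ) (v : V) :
    ∑ u, (G.finsetWalkLength n v u).card ≤ G.maxDegree ^ n := by
  have h : ∀ u, (G.finsetWalkLength n v u).card = (G.adjMatrix ℕ ^ n) v u := by
    intro u
    rw [adjMatrix_pow_apply_eq_card_walk, card_set_walk_length_eq]
    rfl
  simp only [h]
  clear h
  induction n generalizing v with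
  | zero => simp [Matrix.one_apply]
  | succ n ih =>
    simp only [pow_succ' (G.adjMatrix ℕ), adjMatrix_mul_apply]
    rw [Finset.sum_comm]
    calc ∑ w ∈ G.neighborFinset v, ∑ u, (G.adjMatrix ℕ ^ n) w u
        ≤ ∑ w ∈ G.neighborFinset v, G.maxDegree ^ n := Finset.sum_le_sum fun w _ => ih w
      _ = G.degree v * G.maxDegree ^ n := by simp
      _ ≤ G.maxDegree ^ (n + 1) := by
        rw [pow_succ']
        exact Nat.mul_le_mul_right _ (G.degree_le_maxDegree v)

open Classical in
/-- The cycles of length `n` through `v`, as closed walks, in which no two vertices at distance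
two along the cycle are crowded. -/
noncomputable def uncrowdedCycles (s n : ℕ) (v : V) : Finset (G.Walk v v) :=
  (G.finsetWalkLength n v v).filter fun w =>
    w.IsCycle ∧ ∀ i, i + 2 ≤ n → ¬ G.Crowded s (w.getVert i) (w.getVert (i + 2))

variable {G}

/-- Cut off the last four edges. The initial walks number at most `Δⁿ` over all endpoints `u`, and
for each `u` the tail is one of the paths counted by `card_paths_le`. There `u = v` is allowed,
which covers `n = 0`. -/
theorem card_uncrowdedCycles_le {t s : ℕ} (ht : 3 ≤ t) (hG : (cycleGraph (2 * t)).Free G)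
    (n : ℕ) (v : V) :
    (G.uncrowdedCycles s (n + 4) v).card ≤
      G.maxDegree ^ n * (28 * (s * t ^ 2 * G.maxDegree)) := by
  classical
  set Q : ∀ u, Finset (G.Walk u v) := fun u => (G.finsetWalkLength 4 u v).filter fun q =>
    (q.getVert 3 ≠ q.getVert 1 ∧ q.getVert 2 ≠ u ∧ q.getVert 2 ≠ v) ∧
      G.codegree (q.getVert 1) (q.getVert 3) < s ∧ G.codegree u (q.getVert 2) < s ∧
      G.codegree v (q.getVert 2) < s with hQ
  have hQc : ∀ u, (Q u).card ≤ 28 * (s * t ^ 2 * G.maxDegree) := by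
    intro u
    have hlen : ∀ q ∈ Q u, q.length = 4 := fun q hq =>
      mem_finsetWalkLength_iff.1 (Finset.mem_filter.1 hq).1
    have hend : ∀ q ∈ Q u, q.getVert 4 = v := fun q hq => by
      rw [← hlen q hq, Walk.getVert_length]
    rw [← Finset.card_image_of_injOn
      (f := fun q : G.Walk u v => (q.getVert 1, q.getVert 2, q.getVert 3))]
    · apply card_paths_le ht hG u v
      intro p hp
      obtain ⟨q, hq, rfl⟩ := Finset.mem_image.1 hp
      have hl := hlen q hq
      have h0 := q.adj_getVert_succ (i := 0) (by omega)
      have h1 := q.adj_getVert_succ (i := 1) (by omega)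
      have h2 := q.adj_getVert_succ (i := 2) (by omega)
      have h3 := q.adj_getVert_succ (i := 3) (by omega)
      rw [Walk.getVert_zero] at h0
      simp only [Nat.reduceAdd, hend q hq] at h0 h1 h2 h3
      exact ⟨⟨h0, h1, h2, h3⟩, (Finset.mem_filter.1 hq).2⟩
    · intro q hq q' hq' h
      simp only [Prod.mk.injEq] at h
      refine Walk.ext_getVert_le_length ((hlen q hq).trans (hlen q' hq').symm) fun k hk => ?_
      rw [hlen q hq] at hk
      interval_cases k
      · simp
      · exact h.1
      · exact h.2.1
      · exact h.2.2
      · rw [hend q hq, hend q' hq']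
  have hsub : G.uncrowdedCycles s (n + 4) v ⊆ Finset.univ.biUnion fun u =>
      Finset.image₂ Walk.append (G.finsetWalkLength n v u) (Q u) := by
    intro w hw
    obtain ⟨hl, hc, hs⟩ := Finset.mem_filter.1 hw
    rw [mem_finsetWalkLength_iff] at hl
    simp only [Finset.mem_biUnion, Finset.mem_univ, true_and, Finset.mem_image₂]
    refine ⟨w.getVert n, w.take n, ?_, w.drop n, ?_, w.append_take_drop_eq n⟩
    · rw [mem_finsetWalkLength_iff, Walk.take_length]
      omega
    · have hv : w.getVert (n + 4) = v := by rw [← hl, Walk.getVert_length]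
      have e1 : w.getVert (n + 3) ≠ w.getVert (n + 1) := fun h => by
        have := hc.getVert_injOn' (by simp [hl]) (by simp [hl]) h
        omega
      have e2 : w.getVert (n + 2) ≠ w.getVert n := fun h => by
        have := hc.getVert_injOn' (by simp [hl]) (by simp [hl]) h
        omega
      have e3 : w.getVert (n + 2) ≠ v := fun h => by
        have := (hc.getVert_endpoint_iff (by omega)).1 h
        omega
      have s1 := hs (n + 1) (by omega)
      have s2 := hs n (by omega)
      have s3 := hs (n + 2) (by omega)
      simp only [Crowded, not_and, not_not, add_assoc, Nat.reduceAdd, hv] at s1 s2 s3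
      refine Finset.mem_filter.2 ⟨?_, ?_⟩
      · rw [mem_finsetWalkLength_iff, Walk.drop_length]
        omega
      · simp only [Walk.drop_getVert]
        refine ⟨⟨e1, e2, e3⟩, ?_, ?_, ?_⟩
        · by_contra h; exact e1 (s1 (not_lt.1 h))
        · by_contra h; exact e2 (s2 (not_lt.1 h))
        · by_contra h; rw [G.codegree_comm] at h; exact e3 (s3 (not_lt.1 h)).symm
  calc (G.uncrowdedCycles s (n + 4) v).card
      ≤ ∑ u, (G.finsetWalkLength n v u).card * (Q u).card :=
        (Finset.card_le_card hsub).trans (Finset.card_biUnion_le.trans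
          (Finset.sum_le_sum fun u _ => Finset.card_image₂_le _ _ _))
    _ ≤ ∑ u, (G.finsetWalkLength n v u).card * (28 * (s * t ^ 2 * G.maxDegree)) :=
        Finset.sum_le_sum fun u _ => Nat.mul_le_mul_left _ (hQc u)
    _ ≤ _ := by
        rw [← Finset.sum_mul]
        exact Nat.mul_le_mul_right _ (G.sum_card_finsetWalkLength_le n v)

end CycleCounting

end SimpleGraph

/-! ### Rosenfeld's counting argument for general constraints. -/

section RosenfeldCounting

open Finset

variable {V : Type*} [Fintype V] [DecidableEq V] {k : ℕ}

/-- Overwriting the values on `T` arbitrarily preserves `P`. It is injective on pairs, because under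
`Q` the original function is recovered from its values off `T`. -/
theorem card_filter_mul_pow_le (T : Finset V) (P Q : (V → Fin k) → Prop) [DecidablePred P]
    [DecidablePred Q] (hP : ∀ f g : V → Fin k, (∀ x ∉ T, f x = g x) → P f → P g)
    (hQ : ∀ f g : V → Fin k, Q f → Q g → (∀ x ∉ T, f x = g x) → f = g) :
    (univ.filter fun f => P f ∧ Q f).card * k ^ T.card ≤ (univ.filter P).card := by
  have hc : Fintype.card (T → Fin k) = k ^ T.card := by simp
  rw [← hc, ← Finset.card_univ, ← Finset.card_product]
  have key : ∀ (f : V → Fin k) (h : T → Fin k), ∀ x ∉ T,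
      f x = (fun x => if hx : x ∈ T then h ⟨x, hx⟩ else f x) x := by
    intro f h x hx
    simp [hx]
  refine Finset.card_le_card_of_injOn
    (fun q x => if hx : x ∈ T then q.2 ⟨x, hx⟩ else q.1 x) ?_ ?_
  · rintro ⟨f, h⟩ hf
    have hf : P f ∧ Q f := by simpa using hf
    simpa using hP f _ (key f h) hf.1
  · rintro ⟨f, h⟩ hf ⟨f', h'⟩ hf' heq
    have hf : P f ∧ Q f := by simpa using hf
    have hf' : P f' ∧ Q f' := by simpa using hf'
    have hff : f = f' := hQ f f' hf.2 hf'.2 fun x hx => by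
      have := congrFun heq x
      simpa [hx] using this
    refine Prod.ext hff (funext fun x => ?_)
    have := congrFun heq x
    simpa using this

variable (P : Finset V → (V → Fin k) → Prop)

open Classical in
/-- The number of functions satisfying the constraint `P S`. -/
noncomputable def solutionCount (S : Finset V) : ℕ := (univ.filter (P S)).card

variable {P}

theorem pow_mul_solutionCount_sdiff_le {β : ℝ} (hβ : 0 ≤ β) {S : Finset V}
    (h : ∀ S' ⊂ S, ∀ v ∉ S',
      β * solutionCount P S' ≤ k * solutionCount P (insert v S')) (T : Finset V) (hT : T ⊆ S) :
    β ^ T.card * solutionCount P (S \ T) ≤ (k : ℝ) ^ T.card * solutionCount P S := by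
  induction T using Finset.induction with
  | empty => simp
  | insert v T hv ih =>
    have ih := ih ((Finset.subset_insert _ _).trans hT)
    have hvS : v ∈ S := hT (Finset.mem_insert_self _ _)
    have hss : S \ insert v T ⊂ S := Finset.ssubset_iff_subset_ne.2
      ⟨Finset.sdiff_subset, fun he => by
        have := he ▸ hvS
        simp at this⟩
    have h1 := h (S \ insert v T) hss v (by simp)
    have h2 : insert v (S \ insert v T) = S \ T := by
      ext x
      by_cases hx : x = v
      · subst hx; simp [hvS, hv]
      · simp [hx]
    rw [h2] at h1
    rw [Finset.card_insert_of_notMem hv]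
    calc β ^ (T.card + 1) * solutionCount P (S \ insert v T)
        = β ^ T.card * (β * solutionCount P (S \ insert v T)) := by ring
      _ ≤ β ^ T.card * (k * solutionCount P (S \ T)) := by gcongr
      _ = k * (β ^ T.card * solutionCount P (S \ T)) := by ring
      _ ≤ k * ((k : ℝ) ^ T.card * solutionCount P S) := by gcongr
      _ = _ := by ring

/-- For a bad event `Q i`, forget the constraint on `T i`: this gives at most `k⁻ʲ⁻¹` times the
count for `S \ T i`, where `j = |T i| - 1`. Restoring the `j` vertices of `T i` other than `v` by
the induction hypothesis costs a factor `(k/β)ʲ`. So the event takes at most a `β⁻ʲ/k` share of the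
solutions on `S`. -/
theorem mul_solutionCount_le_insert (hmono : ∀ S S' f, S ⊆ S' → P S' f → P S f)
    (hcongr : ∀ S f g, (∀ x ∈ S, f x = g x) → P S f → P S g)
    {β : ℝ} (hβ : 0 < β) (hk : 0 < k) {S : Finset V} {v : V} (hv : v ∉ S)
    (h : ∀ S' ⊂ S, ∀ v ∉ S', β * solutionCount P S' ≤ k * solutionCount P (insert v S'))
    {ι : Type*} (I : Finset ι) (T : ι → Finset V) (Q : ι → (V → Fin k) → Prop)
    (hT : ∀ i ∈ I, v ∈ T i ∧ T i ⊆ insert v S)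
    (hQ : ∀ i ∈ I, ∀ f g, Q i f → Q i g → (∀ x ∉ T i, f x = g x) → f = g)
    (hbad : ∀ f, P S f → ¬ P (insert v S) f → ∃ i ∈ I, Q i f)
    (hsum : β + ∑ i ∈ I, (β ^ ((T i).card - 1))⁻¹ ≤ k) :
    β * solutionCount P S ≤ k * solutionCount P (insert v S) := by
  classical
  have hcover : solutionCount P S ≤ solutionCount P (insert v S) +
      ∑ i ∈ I, (univ.filter fun f => P S f ∧ Q i f).card := by
    refine le_trans (Finset.card_le_card ?_) ((Finset.card_union_le _ _).trans
      (Nat.add_le_add_left (Finset.card_biUnion_le (s := I)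
        (t := fun i => univ.filter fun f => P S f ∧ Q i f)) _))
    intro f hf
    have hf := (Finset.mem_filter.1 hf).2
    by_cases hfi : P (insert v S) f
    · simp [hfi]
    · obtain ⟨i, hi, hq⟩ := hbad f hf hfi
      simp only [Finset.mem_union, Finset.mem_biUnion, Finset.mem_filter, Finset.mem_univ, true_and]
      exact Or.inr ⟨i, hi, hf, hq⟩
  have hk' : (0 : ℝ) < k := Nat.cast_pos.2 hk
  have hone : ∀ i ∈ I, (k : ℝ) * (univ.filter fun f => P S f ∧ Q i f).card ≤
      (β ^ ((T i).card - 1))⁻¹ * solutionCount P S := by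
    intro i hi
    obtain ⟨hvT, hTS⟩ := hT i hi
    have h1 : (univ.filter fun f => P S f ∧ Q i f).card * k ^ (T i).card ≤
        solutionCount P (S \ T i) := by
      refine le_trans (Nat.mul_le_mul_right _ (Finset.card_le_card ?_))
        (card_filter_mul_pow_le (T i) (P (S \ T i)) (Q i) ?_ (hQ i hi))
      · intro f hf
        simp only [Finset.mem_filter, Finset.mem_univ, true_and] at hf ⊢
        exact ⟨hmono _ _ _ Finset.sdiff_subset hf.1, hf.2⟩
      · intro f g hfg
        exact hcongr _ f g fun x hx => hfg x (Finset.mem_sdiff.1 hx).2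
    have hTe : (T i).erase v ⊆ S := fun x hx => by
      have := hTS (Finset.mem_of_mem_erase hx)
      simpa [Finset.ne_of_mem_erase hx] using this
    have h2 := pow_mul_solutionCount_sdiff_le hβ.le h ((T i).erase v) hTe
    have h3 : S \ (T i).erase v = S \ T i := by
      ext x
      by_cases hx : x = v
      · subst hx; simp [hv]
      · simp [hx]
    rw [h3, Finset.card_erase_of_mem hvT] at h2
    have h4 : (T i).card = (T i).card - 1 + 1 := by
      have := Finset.card_pos.2 ⟨v, hvT⟩
      omega
    set j := (T i).card - 1
    rw [h4] at h1
    have h1' : ((univ.filter fun f => P S f ∧ Q i f).card : ℝ) * (k : ℝ) ^ (j + 1) ≤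
        solutionCount P (S \ T i) := by exact_mod_cast h1
    rw [inv_mul_eq_div, le_div_iff₀ (by positivity)]
    have h5 : (k : ℝ) ^ j * ((k : ℝ) * (univ.filter fun f => P S f ∧ Q i f).card * β ^ j) ≤
        (k : ℝ) ^ j * solutionCount P S := by
      calc _ = β ^ j * (((univ.filter fun f => P S f ∧ Q i f).card : ℝ) * (k : ℝ) ^ (j + 1)) := by
            ring
        _ ≤ β ^ j * solutionCount P (S \ T i) := by gcongr
        _ ≤ _ := h2
    exact le_of_mul_le_mul_left h5 (by positivity)
  have hcover' : (solutionCount P S : ℝ) ≤ solutionCount P (insert v S) +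
      ∑ i ∈ I, ((univ.filter fun f => P S f ∧ Q i f).card : ℝ) := by exact_mod_cast hcover
  have h6 : (k : ℝ) * ∑ i ∈ I, ((univ.filter fun f => P S f ∧ Q i f).card : ℝ) ≤
      (∑ i ∈ I, (β ^ ((T i).card - 1))⁻¹) * solutionCount P S := by
    rw [Finset.mul_sum, Finset.sum_mul]
    exact Finset.sum_le_sum hone
  have h7 := mul_le_mul_of_nonneg_left hcover' hk'.le
  have h8 := mul_le_mul_of_nonneg_right hsum (Nat.cast_nonneg (solutionCount P S) : (0 : ℝ) ≤ _)
  nlinarith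

end RosenfeldCounting

namespace SimpleGraph

/-! ### Two-coloured cycles and the constraint to be counted. -/

section Alternates

variable {V : Type*} [DecidableEq V] {G : SimpleGraph V}

/-- A closed walk along which colours repeat with period two. -/
def Walk.Alternates {α : Type*} {v : V} (w : G.Walk v v) (f : V → α) : Prop :=
  ∀ i, i + 2 ≤ w.length → f (w.getVert i) = f (w.getVert (i + 2))

/-- The colours at positions 1 and 2 propagate to the whole cycle. These are used rather than 0 and
1 so that `v`, at position `w.length`, is among the determined vertices. -/
theorem Walk.IsCycle.eq_of_alternates {α : Type*} {v : V} {w : G.Walk v v} (hw : w.IsCycle)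
    {f g : V → α} (hf : w.Alternates f) (hg : w.Alternates g)
    (h : ∀ x ∉ (Finset.Icc 3 w.length).image w.getVert, f x = g x) : f = g := by
  have hl := hw.three_le_length
  have hsmall : ∀ i, 1 ≤ i → i ≤ 2 → f (w.getVert i) = g (w.getVert i) := by
    intro i hi hi'
    apply h
    simp only [Finset.mem_image, Finset.mem_Icc, not_exists, not_and]
    intro j hj hji
    have := hw.getVert_injOn ⟨by omega, hj.2⟩ ⟨hi, by omega⟩ hji
    omega
  have hall : ∀ i, 1 ≤ i → i ≤ w.length → f (w.getVert i) = g (w.getVert i) := by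
    intro i
    induction i using Nat.strong_induction_on with
    | _ i ih =>
      intro h1 h2
      by_cases h3 : i ≤ 2
      · exact hsmall i h1 h3
      · obtain ⟨j, rfl⟩ : ∃ j, i = j + 2 := ⟨i - 2, by omega⟩
        rw [← hf j h2, ← hg j h2]
        exact ih j (by omega) (by omega) (by omega)
  funext x
  by_cases hx : x ∈ (Finset.Icc 3 w.length).image w.getVert
  · obtain ⟨i, hi, rfl⟩ := Finset.mem_image.1 hx
    have := Finset.mem_Icc.1 hi
    exact hall i (by omega) this.2
  · exact h x hx

theorem Walk.IsCycle.card_image_getVert_Icc {v : V} {w : G.Walk v v} (hw : w.IsCycle) :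
    ((Finset.Icc 3 w.length).image w.getVert).card = w.length - 2 := by
  rw [Finset.card_image_of_injOn (hw.getVert_injOn.mono fun i hi => ?_)]
  · simp
  · simp only [Finset.coe_Icc, Set.mem_Icc] at hi
    exact ⟨by omega, hi.2⟩

end Alternates

section UncrowdedColorings

variable {V : Type*} [Fintype V] (G : SimpleGraph V) [DecidableRel G.Adj]

/-- On `S`, the function `f` is a proper acyclic colouring that separates crowded pairs. -/
def IsUncrowdedColoringOn {α : Type*} (s : ℕ) (S : Finset V) (f : V → α) : Prop :=
  (∀ x ∈ S, ∀ y ∈ S, G.Adj x y ∨ G.Crowded s x y → f x ≠ f y) ∧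
    ∀ (x : V) (w : G.Walk x x), w.IsCycle → (∀ y ∈ w.support, y ∈ S) →
      ¬ ∃ a b, ∀ y ∈ w.support, f y = a ∨ f y = b

variable {G}

theorem IsUncrowdedColoringOn.mono {α : Type*} {s : ℕ} {S S' : Finset V} {f : V → α}
    (h : S ⊆ S') (hf : G.IsUncrowdedColoringOn s S' f) : G.IsUncrowdedColoringOn s S f :=
  ⟨fun x hx y hy => hf.1 x (h hx) y (h hy), fun x w hw hS => hf.2 x w hw fun y hy => h (hS y hy)⟩

theorem IsUncrowdedColoringOn.congr {α : Type*} {s : ℕ} {S : Finset V} {f g : V → α}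
    (h : ∀ x ∈ S, f x = g x) (hf : G.IsUncrowdedColoringOn s S f) :
    G.IsUncrowdedColoringOn s S g := by
  refine ⟨fun x hx y hy hxy => h x hx ▸ h y hy ▸ hf.1 x hx y hy hxy, ?_⟩
  rintro x w hw hS ⟨a, b, hab⟩
  exact hf.2 x w hw hS ⟨a, b, fun y hy => h y (hS y hy) ▸ hab y hy⟩

theorem IsUncrowdedColoringOn.acyclicColorable {k s : ℕ} {f : V → Fin k}
    (hf : G.IsUncrowdedColoringOn s Finset.univ f) : G.AcyclicColorable k := by
  let c : G.Coloring (Fin k) :=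
    Coloring.mk f fun {u v} h => hf.1 u (Finset.mem_univ _) v (Finset.mem_univ _) (.inl h)
  refine ⟨c, fun a b x w hw => ?_⟩
  let e := Embedding.induce (G := G) {v | c v = a ∨ c v = b}
  refine hf.2 _ (w.map e.toHom) (hw.map e.injective) (by simp) ⟨a, b, fun y hy => ?_⟩
  rw [Walk.support_map, List.mem_map] at hy
  obtain ⟨z, -, rfl⟩ := hy
  exact z.2

variable [DecidableEq V]

/-- A new two-coloured cycle must pass through `v` and can be rotated to start there. Properness
makes it alternate, so vertices at distance two share a colour and cannot be crowded. The bound by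
`Fintype.card V` keeps the family of events finite. -/
theorem exists_uncrowdedCycle {α : Type*} {s : ℕ} {S : Finset V} {v : V} {f : V → α}
    (hf : G.IsUncrowdedColoringOn s S f)
    (hprop : ∀ x ∈ insert v S, ∀ y ∈ insert v S, G.Adj x y ∨ G.Crowded s x y → f x ≠ f y)
    (hnot : ¬ G.IsUncrowdedColoringOn s (insert v S) f) :
    ∃ n, n + 4 ≤ Fintype.card V ∧ ∃ w ∈ G.uncrowdedCycles s (n + 4) v,
      (∀ y ∈ w.support, y ∈ insert v S) ∧ w.Alternates f := by
  simp only [IsUncrowdedColoringOn, not_and, not_forall, not_not] at hnot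
  obtain ⟨x, c, hc, hcS, a, b, hab⟩ := hnot hprop
  have hv : v ∈ c.support := by
    by_contra hv
    refine hf.2 x c hc (fun y hy => ?_) ⟨a, b, hab⟩
    exact (Finset.mem_insert.1 (hcS y hy)).resolve_left (by rintro rfl; exact hv hy)
  set w := c.rotate v hv
  have hw : w.IsCycle := hc.rotate hv
  have hwS : ∀ y ∈ w.support, y ∈ insert v S := fun y hy =>
    hcS y ((c.mem_support_rotate_iff v hv).1 hy)
  have hwab : ∀ y ∈ w.support, f y = a ∨ f y = b := fun y hy =>
    hab y ((c.mem_support_rotate_iff v hv).1 hy)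
  have hne : ∀ i, i < w.length → f (w.getVert i) ≠ f (w.getVert (i + 1)) := fun i hi =>
    hprop _ (hwS _ (w.getVert_mem_support i)) _ (hwS _ (w.getVert_mem_support _))
      (.inl (w.adj_getVert_succ hi))
  have halt : w.Alternates f := by
    intro i hi
    have h1 := hne i (by omega)
    have h2 := hne (i + 1) (by omega)
    have h3 := hwab _ (w.getVert_mem_support i)
    have h4 := hwab _ (w.getVert_mem_support (i + 1))
    have h5 := hwab _ (w.getVert_mem_support (i + 2))
    rw [add_assoc] at h2
    grind
  have h4 : 4 ≤ w.length := by
    by_contra! hlt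
    have h3 : w.length = 3 := le_antisymm (by omega) hw.three_le_length
    have h1 := halt 0 (by omega)
    have h2 := hne 2 (by omega)
    have h0 : w.getVert 3 = v := by rw [← h3, Walk.getVert_length]
    simp only [Nat.reduceAdd, h0, Walk.getVert_zero] at h1 h2
    exact h2 h1.symm
  have hcard : w.length ≤ Fintype.card V := by
    have := hw.support_nodup.length_le_card
    simpa using this
  obtain ⟨n, hn⟩ : ∃ n, w.length = n + 4 := ⟨w.length - 4, by omega⟩
  refine ⟨n, by omega, w, ?_, hwS, halt⟩
  classical
  refine Finset.mem_filter.2 ⟨mem_finsetWalkLength_iff.2 hn, hw, ?_⟩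
  intro i hi hcr
  exact hprop _ (hwS _ (w.getVert_mem_support i)) _ (hwS _ (w.getVert_mem_support _))
    (.inr hcr) (halt i (by omega))

end UncrowdedColorings

end SimpleGraph

namespace SimpleGraph

/-! ### Summing the weights and choosing the parameters. -/

section AcyclicColorable

variable {V : Type*} [Fintype V] [DecidableEq V] {G : SimpleGraph V} [DecidableRel G.Adj]

theorem sum_inv_pow_mul_pow_le {a β : ℝ} (ha : 0 ≤ a) (hβ : a < β) (N : ℕ) :
    ∑ n ∈ Finset.range N, a ^ n * (β ^ (n + 1))⁻¹ ≤ (β - a)⁻¹ := by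
  have hβ0 : 0 < β := ha.trans_lt hβ
  have hr : a / β < 1 := (div_lt_one hβ0).2 hβ
  have h1 : ∀ n, a ^ n * (β ^ (n + 1))⁻¹ = β⁻¹ * (a / β) ^ n := by
    intro n
    rw [div_pow, pow_succ]
    field_simp
  simp only [h1]
  rw [← Finset.mul_sum]
  have h2 := (summable_geometric_of_lt_one (by positivity) hr).sum_le_tsum (Finset.range N)
    (fun i _ => by positivity)
  rw [tsum_geometric_of_lt_one (by positivity) hr] at h2
  refine (mul_le_mul_of_nonneg_left h2 (by positivity)).trans_eq ?_
  rw [← mul_inv]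
  congr 1
  field_simp

theorem mul_solutionCount_isUncrowdedColoringOn_le {t s k : ℕ} (ht : 3 ≤ t)
    (hG : (cycleGraph (2 * t)).Free G) {β : ℝ} (hβ : (G.maxDegree : ℝ) < β)
    {X : ℝ} (hX : ∀ v, ((Finset.univ.filter fun w => s ≤ G.codegree v w ∧ w ≠ v).card : ℝ) ≤ X)
    (hk : β + (G.maxDegree + X +
      28 * (s * (t : ℝ) ^ 2 * G.maxDegree) * (β - G.maxDegree)⁻¹) ≤ k)
    (hk0 : 0 < k) (S : Finset V) (v : V) (hv : v ∉ S) :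
    β * solutionCount (G.IsUncrowdedColoringOn (α := Fin k) s) S ≤
      k * solutionCount (G.IsUncrowdedColoringOn (α := Fin k) s) (insert v S) := by
  classical
  induction S using Finset.strongInduction generalizing v with
  | H S ih =>
  have hβ0 : 0 < β := (Nat.cast_nonneg _).trans_lt hβ
  set A := Finset.univ.filter fun w => G.Adj v w ∨ G.Crowded s v w with hA
  set C := (Finset.range (Fintype.card V)).sigma fun n =>
    (G.uncrowdedCycles s (n + 4) v).filter fun w => ∀ y ∈ w.support, y ∈ insert v S with hC
  have hCm : ∀ c ∈ C, c.2.length = c.1 + 4 ∧ c.2.IsCycle ∧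
      ∀ y ∈ c.2.support, y ∈ insert v S := by
    intro c hc
    have h1 := Finset.mem_filter.1 (Finset.mem_sigma.1 hc).2
    have h2 := Finset.mem_filter.1 h1.1
    exact ⟨mem_finsetWalkLength_iff.1 h2.1, h2.2.1, h1.2⟩
  refine mul_solutionCount_le_insert (fun S S' f h hf => hf.mono h)
    (fun S f g h hf => hf.congr h) hβ0 hk0 hv ih (A.disjSum C)
    -- A colour conflict determines only `v`, so it has weight 1. A cycle of length `n + 4`
    -- determines `n + 2` vertices, so its weight is `β⁻⁽ⁿ⁺¹⁾`.
    (Sum.elim (fun _ => {v}) fun c => (Finset.Icc 3 c.2.length).image c.2.getVert)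
    (Sum.elim (fun w f => f v = f w) fun c f => c.2.Alternates f) ?_ ?_ ?_ ?_
  · rintro (w | c) hi
    · simp
    · obtain ⟨h1, h2, h3⟩ := hCm c (Finset.inr_mem_disjSum.1 hi)
      simp only [Sum.elim_inr]
      refine ⟨Finset.mem_image.2 ⟨c.2.length, by simp; omega, c.2.getVert_length⟩, ?_⟩
      intro x hx
      obtain ⟨i, -, rfl⟩ := Finset.mem_image.1 hx
      exact h3 _ (c.2.getVert_mem_support i)
  · rintro (w | c) hi f g hf hg h
    · have hw := (Finset.mem_filter.1 (Finset.inl_mem_disjSum.1 hi)).2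
      have hwv : w ≠ v := hw.elim (fun h => h.ne') fun h => h.2
      simp only [Sum.elim_inl, Finset.mem_singleton] at hf hg h
      funext x
      by_cases hx : x = v
      · rw [hx, hf, hg, h w hwv]
      · exact h x hx
    · obtain ⟨h1, h2, h3⟩ := hCm c (Finset.inr_mem_disjSum.1 hi)
      exact h2.eq_of_alternates hf hg h
  · intro f hf hnot
    by_cases hprop : ∀ w, G.Adj v w ∨ G.Crowded s v w → f v ≠ f w
    · have hprop' : ∀ x ∈ insert v S, ∀ y ∈ insert v S,
          G.Adj x y ∨ G.Crowded s x y → f x ≠ f y := by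
        intro x hx y hy hxy
        rcases Finset.mem_insert.1 hx with rfl | hx
        · exact hprop y hxy
        · rcases Finset.mem_insert.1 hy with rfl | hy
          · exact (hprop x (hxy.imp (fun h => h.symm) fun h => h.symm)).symm
          · exact hf.1 x hx y hy hxy
      obtain ⟨n, hn, w, hw, hwS, halt⟩ := exists_uncrowdedCycle hf hprop' hnot
      refine ⟨.inr ⟨n, w⟩, Finset.inr_mem_disjSum.2 ?_, halt⟩
      exact Finset.mem_sigma.2 ⟨by simp; omega, Finset.mem_filter.2 ⟨hw, hwS⟩⟩
    · push Not at hprop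
      obtain ⟨w, hw, hfw⟩ := hprop
      exact ⟨.inl w, by simp [hA, hw], hfw⟩
  · refine le_trans (add_le_add_right ?_ β) hk
    rw [Finset.sum_disjSum]
    refine add_le_add ?_ ?_
    · simp only [Sum.elim_inl, Finset.card_singleton, Nat.sub_self, pow_zero, inv_one,
        Finset.sum_const, nsmul_eq_mul, mul_one]
      have h1 : A.card ≤ G.maxDegree +
          (Finset.univ.filter fun w => s ≤ G.codegree v w ∧ w ≠ v).card := by
        rw [hA, Finset.filter_or]
        refine (Finset.card_union_le _ _).trans (add_le_add ?_
          (Finset.card_le_card fun w hw => by simpa [Crowded] using hw))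
        exact card_le_maxDegree_of_forall_adj (v := v) (by simp)
      calc (A.card : ℝ) ≤ G.maxDegree +
            ((Finset.univ.filter fun w => s ≤ G.codegree v w ∧ w ≠ v).card : ℝ) := by
              exact_mod_cast h1
        _ ≤ _ := by gcongr; exact hX v
    · rw [hC, Finset.sum_sigma]
      simp only [Sum.elim_inr]
      set p : ℝ := 28 * (s * (t : ℝ) ^ 2 * G.maxDegree) with hp
      calc _ ≤ ∑ n ∈ Finset.range (Fintype.card V),
            ((G.maxDegree : ℝ) ^ n * p) * (β ^ (n + 1))⁻¹ := by
            refine Finset.sum_le_sum fun n hn => ?_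
            have h2 : ∀ w ∈ (G.uncrowdedCycles s (n + 4) v).filter
                fun w => ∀ y ∈ w.support, y ∈ insert v S,
                (β ^ (((Finset.Icc 3 w.length).image w.getVert).card - 1))⁻¹ =
                  (β ^ (n + 1))⁻¹ := by
              intro w hw
              obtain ⟨h1, h2, -⟩ := hCm ⟨n, w⟩ (Finset.mem_sigma.2 ⟨hn, hw⟩)
              dsimp only at h1 h2
              rw [h2.card_image_getVert_Icc, h1]
              rfl
            rw [Finset.sum_congr rfl h2, Finset.sum_const, nsmul_eq_mul]
            refine mul_le_mul_of_nonneg_right ?_ (by positivity)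
            have h3 := (Finset.card_filter_le (G.uncrowdedCycles s (n + 4) v)
              fun w => ∀ y ∈ w.support, y ∈ insert v S).trans
              (card_uncrowdedCycles_le (s := s) ht hG n v)
            rw [hp]
            exact_mod_cast h3
        _ = p * ∑ n ∈ Finset.range (Fintype.card V),
              (G.maxDegree : ℝ) ^ n * (β ^ (n + 1))⁻¹ := by
            rw [Finset.mul_sum]
            exact Finset.sum_congr rfl fun n _ => by ring
        _ ≤ _ := mul_le_mul_of_nonneg_left
            (sum_inv_pow_mul_pow_le (Nat.cast_nonneg _) hβ _) (by positivity)

theorem acyclicColorable_of_cycleGraph_free {t s k : ℕ} (ht : 3 ≤ t)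
    (hG : (cycleGraph (2 * t)).Free G) {β : ℝ} (hβ : (G.maxDegree : ℝ) < β)
    {X : ℝ} (hX : ∀ v, ((Finset.univ.filter fun w => s ≤ G.codegree v w ∧ w ≠ v).card : ℝ) ≤ X)
    (hk : β + (G.maxDegree + X +
      28 * (s * (t : ℝ) ^ 2 * G.maxDegree) * (β - G.maxDegree)⁻¹) ≤ k)
    (hk0 : 0 < k) : G.AcyclicColorable k := by
  classical
  have hβ0 : 0 < β := (Nat.cast_nonneg _).trans_lt hβ
  have hpos : ∀ S : Finset V, 0 < solutionCount (G.IsUncrowdedColoringOn (α := Fin k) s) S := by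
    intro S
    induction S using Finset.induction with
    | empty =>
      refine Finset.card_pos.2 ⟨fun _ => ⟨0, hk0⟩, Finset.mem_filter.2 ⟨Finset.mem_univ _, ?_, ?_⟩⟩
      · simp
      · intro x w _ hw
        exact absurd (hw x w.start_mem_support) (Finset.notMem_empty x)
    | insert v S hv ih =>
      have h1 := mul_solutionCount_isUncrowdedColoringOn_le ht hG hβ hX hk hk0 S v hv
      have h2 : 0 < β * solutionCount (G.IsUncrowdedColoringOn (α := Fin k) s) S :=
        mul_pos hβ0 (Nat.cast_pos.2 ih)
      exact_mod_cast pos_of_mul_pos_right (h2.trans_le h1) (Nat.cast_nonneg k)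
  obtain ⟨f, hf⟩ := Finset.card_pos.1 (hpos Finset.univ)
  exact (Finset.mem_filter.1 hf).2.acyclicColorable

theorem acyclicChromaticNumber_le_of_cycleGraph_free {t : ℕ} (ht : 3 ≤ t)
    (hG : (cycleGraph (2 * t)).Free G) (hΔ : t ^ 3 ≤ G.maxDegree) :
    (G.acyclicChromaticNumber : ℝ) ≤
      2 * (G.maxDegree : ℝ) + 227 * (t : ℝ) * (G.maxDegree : ℝ) ^ ((2 : ℝ) / 3) := by
  set Δ : ℝ := (G.maxDegree : ℝ) with hΔdef
  have hΔ0 : 0 ≤ Δ := Nat.cast_nonneg _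
  set δ : ℝ := Δ ^ ((1 : ℝ) / 3) with hδ
  have hδ0 : 0 ≤ δ := by positivity
  have hδ3 : δ ^ 3 = Δ := by
    rw [hδ, ← Real.rpow_natCast, ← Real.rpow_mul hΔ0]; norm_num
  have hδ2 : Δ ^ ((2 : ℝ) / 3) = δ ^ 2 := by
    rw [hδ, ← Real.rpow_natCast, ← Real.rpow_mul hΔ0]; norm_num
  have ht3 : (3 : ℝ) ≤ t := by exact_mod_cast ht
  have htδ : (t : ℝ) ≤ δ := by
    have h1 : (t : ℝ) ^ 3 ≤ δ ^ 3 := by rw [hδ3, hΔdef]; exact_mod_cast hΔ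
    exact le_of_pow_le_pow_left₀ (by norm_num) hδ0 h1
  have hδ1 : 3 ≤ δ := ht3.trans htδ
  -- The factor 4 and `t ≤ δ` give `4 * t ≤ s`, as the codegree bound requires; this is where `t ^ 3
  -- ≤ Δ` enters.
  set s : ℕ := 4 * ⌈δ⌉₊ with hs
  have hs1 : 4 * δ ≤ s := by
    rw [hs]; push_cast
    linarith [Nat.le_ceil δ]
  have hs2 : (s : ℝ) ≤ 8 * δ := by
    rw [hs]; push_cast
    linarith [Nat.ceil_lt_add_one hδ0]
  have hst : 4 * t ≤ s := by
    have : (4 * t : ℝ) ≤ s := by linarith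
    exact_mod_cast this
  -- In units of `tδ²`: 1 from `β`, 1 from crowded partners and `28 · 8 = 224` from cycles. Rounding
  -- up costs at most one more unit, giving 227.
  set k : ℕ := ⌈2 * Δ + 226 * (t * δ ^ 2)⌉₊ with hk
  have hr : 1 ≤ t * δ ^ 2 := by nlinarith
  have hk1 : 2 * Δ + 226 * (t * δ ^ 2) ≤ k := Nat.le_ceil _
  have hk2 : (k : ℝ) < 2 * Δ + 226 * (t * δ ^ 2) + 1 := Nat.ceil_lt_add_one (by positivity)
  have hcol : G.AcyclicColorable k := by
    refine acyclicColorable_of_cycleGraph_free (s := s) (β := Δ + t * δ ^ 2) (X := t * δ ^ 2)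
      ht hG (by linarith) (fun v => ?_) ?_ ?_
    · have h1 : (s : ℝ) * ((Finset.univ.filter fun b => s ≤ G.codegree v b ∧ b ≠ v).card : ℝ) ≤
          4 * t * Δ := by
        rw [hΔdef]
        exact_mod_cast mul_card_large_codegree_le ht hG hst v
      set c : ℝ := ((Finset.univ.filter fun b => s ≤ G.codegree v b ∧ b ≠ v).card : ℝ) with hc
      have hc0 : 0 ≤ c := Nat.cast_nonneg _
      have h2 : (4 * δ) * c ≤ (4 * δ) * (t * δ ^ 2) := by
        calc (4 * δ) * c ≤ s * c := by gcongr
          _ ≤ 4 * t * Δ := h1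
          _ = _ := by rw [← hδ3]; ring
      exact le_of_mul_le_mul_left h2 (by positivity)
    · refine le_trans ?_ hk1
      have h1 : 28 * (s * (t : ℝ) ^ 2 * Δ) * (Δ + t * δ ^ 2 - Δ)⁻¹ ≤ 224 * (t * δ ^ 2) := by
        rw [add_sub_cancel_left, mul_inv_le_iff₀ (by linarith)]
        calc 28 * (s * (t : ℝ) ^ 2 * Δ) ≤ 28 * (8 * δ * (t : ℝ) ^ 2 * Δ) := by gcongr
          _ = _ := by rw [← hδ3]; ring
      linarith
    · have : (0 : ℝ) < k := by linarith
      exact_mod_cast this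
  have hle : (G.acyclicChromaticNumber : ℝ) ≤ k := by
    exact_mod_cast Nat.sInf_le hcol
  rw [hδ2]
  linarith

end AcyclicColorable

end SimpleGraph

theorem mainTheorem5 :
    ∃ C : ℝ, 0 < C ∧
      ∀ (t : ℕ), 3 ≤ t →
      ∀ (V : Type*) [Fintype V] (G : SimpleGraph V) [DecidableRel G.Adj],
        (SimpleGraph.cycleGraph (2 * t)).Free G →
        t ^ 3 ≤ G.maxDegree →
        (G.acyclicChromaticNumber : ℝ) ≤
          2 * (G.maxDegree : ℝ) + C * (t : ℝ) * (G.maxDegree : ℝ) ^ ((2 : ℝ) / 3) := by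
  refine ⟨227, by norm_num, fun t ht V _ G _ hG hΔ => ?_⟩
  classical
  exact SimpleGraph.acyclicChromaticNumber_le_of_cycleGraph_free ht hG hΔ
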